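/- Let $X$ be a (real) Banach lattice. A sequence $(x_n)$ in $X$ is called un-null if $\bigl\| |x_n|\wedge u\bigr\|\to 0$ for every $u\in X_+$. The space $X$ is order continuous if $\|x_\alpha\|\to 0$ for every net $x_\alpha\downarrow 0$ in $X$. A non-zero element $a\in X_+$ is an atom if the ideal $I_a=\{x\in X: |x|\le c\,a \text{ for some } c\ge 0\}$ consists only of the scalar multiples of $a$, and $X$ is atomic if it equals the band generated by all its atoms. Then the following are equivalent: 1. every sequence $(x_n)$ in $X$ that converges weakly to $0$ is un-null; 2. $X$ is order continuous and atomic. -/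

import Mathlib

open Filter Topology

namespace BanachLattice

section Definitions

variable {X : Type*} [NormedAddCommGroup X] [NormedSpace ℝ X] [Lattice X]

/-- Unbounded norm convergence: `|x i - a| ⊓ u → 0` in norm for every `u ≥ 0`. -/
def UnTendsto {ι : Type*} (x : ι → X) (l : Filter ι) (a : X) : Prop :=
  ∀ u : X, 0 ≤ u → Tendsto (fun i => ‖|x i - a| ⊓ u‖) l (𝓝 0)

/-- Convergence in the weak topology `σ(X, X*)`. -/
def WeakTendsto {ι : Type*} (x : ι → X) (l : Filter ι) (a : X) : Prop :=
  Tendsto (fun i => toWeakSpace ℝ X (x i)) l (𝓝 (toWeakSpace ℝ X a))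

variable (X) in
/-- The norm is order continuous: `x_α ↓ 0` implies `‖x_α‖ → 0`. A decreasing net with infimum `0`
is presented by its range, a nonempty downward directed set `D` with infimum `0`; along such a
net the norms decrease, so they tend to `0` as soon as they get arbitrarily small. -/
def IsOrderContinuous : Prop :=
  ∀ D : Set X, D.Nonempty → DirectedOn (fun x y => y ≤ x) D → IsGLB D 0 →
    ∀ ε : ℝ, 0 < ε → ∃ x ∈ D, ‖x‖ < ε

/-- The ideal `I_a` generated by `a`. -/
def principalIdeal (a : X) : Set X :=
  {x | ∃ c : ℝ, |x| ≤ c • |a|}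

/-- A nonzero `a ≥ 0` is an atom if `I_a` consists exactly of the scalar multiples of `a`. -/
def IsLatticeAtom (a : X) : Prop :=
  0 ≤ a ∧ a ≠ 0 ∧ principalIdeal a = {x | ∃ c : ℝ, x = c • a}

/-- A band: an ideal (solid linear subspace) that contains the supremum of each of its nonempty
subsets whose supremum exists in `X`. -/
def IsBand (B : Submodule ℝ X) : Prop :=
  LatticeOrderedAddCommGroup.IsSolid (B : Set X) ∧
    ∀ (D : Set X) (x : X), D.Nonempty → D ⊆ B → IsLUB D x → x ∈ B

/-- The band generated by `S`: the intersection of all bands that contain `S`. -/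
def bandGenerated (S : Set X) : Submodule ℝ X :=
  sInf {B | IsBand B ∧ S ⊆ B}

variable (X) in
/-- `X` is atomic if it equals the band generated by all its atoms. -/
def IsAtomicLattice : Prop :=
  bandGenerated {a : X | IsLatticeAtom a} = ⊤

end Definitions

end BanachLattice

set_option linter.unusedSectionVars false

namespace BanachLattice

/-! ### Disjointness and order estimates -/

section LatticeGroup

variable {G : Type*} [AddCommGroup G] [Lattice G] [IsOrderedAddMonoid G]

/-! (2 ⇒ 1) For a fixed weakly null sequence `x`, the elements `w` with `‖|x n| ⊓ |w|‖ → 0` form a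
solid subspace, and order continuity makes it a band. It contains each atom `a`: a coordinate
functional `g` satisfies `|x| ⊓ a ≤ |g x| • a`, so weak convergence suffices there. In an atomic
lattice this band is everything.

(1 ⇒ 2) An order bounded disjoint sequence is weakly null, hence un-null by (1), hence norm null
because it is order bounded. In a Banach lattice this forces order bounded increasing sequences to
be Cauchy (`DisjointNull.monotoneCauchy`): increments that stay large could be refined to a disjoint
sequence that stays large. Suprema of bounded directed sets then exist as norm limits, which gives
order continuity.

If `X` is not atomic, some `e > 0` has no atom below it, and `e` can be shrunk so that a positive
functional `f` is strictly positive on `[0, e]`. Without atoms each component of `e` splits into two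
disjoint parts of equal `f`-mass, so `[0, e]` carries a Rademacher sequence with `|r n| = e`. It is
weakly null: averages of `N` signed terms have `f`-mass `O(N^(-1/2))`, and on `[0, e]` small
`f`-mass implies small norm. But `|r n| ⊓ e = e` does not tend to `0`, contradicting (1). -/

theorem inf_add_le_inf_add_inf {x a b : G} (hx : 0 ≤ x) (ha : 0 ≤ a) (hb : 0 ≤ b) :
    x ⊓ (a + b) ≤ x ⊓ a + x ⊓ b := by
  rw [add_inf, inf_add, inf_add]
  refine le_inf (le_inf ?_ ?_) (le_inf ?_ inf_le_right)
  · exact inf_le_left.trans (le_add_of_nonneg_left hx)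
  · exact inf_le_left.trans (le_add_of_nonneg_left ha)
  · exact inf_le_left.trans (le_add_of_nonneg_right hb)

theorem inf_add_eq_zero {x a b : G} (hx : 0 ≤ x) (ha : 0 ≤ a) (hb : 0 ≤ b)
    (hxa : x ⊓ a = 0) (hxb : x ⊓ b = 0) : x ⊓ (a + b) = 0 :=
  le_antisymm ((inf_add_le_inf_add_inf hx ha hb).trans (by simp [hxa, hxb]))
    (le_inf hx (add_nonneg ha hb))

theorem inf_eq_zero_of_le {x y a b : G} (ha : 0 ≤ a) (hb : 0 ≤ b) (hax : a ≤ x) (hby : b ≤ y)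
    (h : x ⊓ y = 0) : a ⊓ b = 0 :=
  le_antisymm ((inf_le_inf hax hby).trans h.le) (le_inf ha hb)

theorem inf_sum_eq_zero {ι : Type*} {x : G} {a : ι → G} {s : Finset ι} (hx : 0 ≤ x)
    (ha : ∀ i ∈ s, 0 ≤ a i) (h : ∀ i ∈ s, x ⊓ a i = 0) : x ⊓ ∑ i ∈ s, a i = 0 := by
  classical
  induction s using Finset.induction_on with
  | empty => simpa using hx
  | insert i s hi ih =>
    rw [Finset.sum_insert hi]
    exact inf_add_eq_zero hx (ha i (by simp))
      (Finset.sum_nonneg fun j hj => ha j (by simp [hj])) (h i (by simp))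
      (ih (fun j hj => ha j (by simp [hj])) fun j hj => h j (by simp [hj]))

theorem nsmul_inf_eq_zero {x a : G} (hx : 0 ≤ x) (ha : 0 ≤ a) (h : x ⊓ a = 0) (n : ℕ) :
    x ⊓ n • a = 0 := by
  simpa using inf_sum_eq_zero (s := Finset.range n) (a := fun _ => a) hx (fun _ _ => ha)
    fun _ _ => h

theorem abs_sum_le_sum {ι : Type*} {s : Finset ι} {x y : ι → G} (h : ∀ i ∈ s, |x i| ≤ y i) :
    |∑ i ∈ s, x i| ≤ ∑ i ∈ s, y i := by
  refine abs_le'.2 ⟨Finset.sum_le_sum fun i hi => (le_abs_self _).trans (h i hi), ?_⟩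
  rw [← Finset.sum_neg_distrib]
  exact Finset.sum_le_sum fun i hi => (neg_le_abs _).trans (h i hi)

end LatticeGroup

section VectorLattice

variable {X : Type*} [AddCommGroup X] [Module ℝ X] [Lattice X] [IsOrderedAddMonoid X]
  [IsOrderedModule ℝ X]

theorem abs_smul_le (c : ℝ) (x : X) : |c • x| ≤ |c| • |x| := by
  have key : ∀ (c : ℝ) (x : X), c • x ≤ |c| • |x| := fun c x => by
    rcases le_total 0 c with hc | hc
    · rw [abs_of_nonneg hc]
      exact smul_le_smul_of_nonneg_left (le_abs_self x) hc
    · rw [abs_of_nonpos hc, ← neg_smul_neg]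
      exact smul_le_smul_of_nonneg_left (neg_le_abs x) (by linarith)
  refine abs_le'.2 ⟨key c x, ?_⟩
  simpa using key (-c) x

/-- The factor `c + 1` dominates both `1` and `c`, so no case split on `c` is needed. -/
theorem inf_smul_le {x a : X} (hx : 0 ≤ x) (ha : 0 ≤ a) {c : ℝ} (hc : 0 ≤ c) :
    x ⊓ c • a ≤ (c + 1) • (x ⊓ a) := by
  have h1 : x ⊓ c • a ≤ (c + 1) • x := by
    refine inf_le_left.trans ?_
    rw [add_smul, one_smul]
    exact le_add_of_nonneg_left (smul_nonneg hc hx)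
  have h2 : x ⊓ c • a ≤ (c + 1) • a := by
    refine inf_le_right.trans ?_
    rw [add_smul, one_smul]
    exact le_add_of_nonneg_right ha
  have hp : (0 : ℝ) < c + 1 := by linarith
  rw [← inv_smul_le_iff_of_pos hp]
  exact le_inf ((inv_smul_le_iff_of_pos hp).2 h1) ((inv_smul_le_iff_of_pos hp).2 h2)

end VectorLattice

section NormedLattice

variable {X : Type*} [NormedAddCommGroup X] [Lattice X] [IsOrderedAddMonoid X] [HasSolidNorm X]

theorem norm_le_norm_of_nonneg_of_le {x y : X} (hx : 0 ≤ x) (h : x ≤ y) : ‖x‖ ≤ ‖y‖ :=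
  norm_le_norm_of_abs_le_abs (by rwa [abs_of_nonneg hx, abs_of_nonneg (hx.trans h)])

end NormedLattice

theorem weakTendsto_zero_iff {X : Type*} [NormedAddCommGroup X] [NormedSpace ℝ X] {x : ℕ → X} :
    WeakTendsto x atTop 0 ↔ ∀ g : StrongDual ℝ X, Tendsto (fun n => g (x n)) atTop (𝓝 0) := by
  have := WeakBilin.tendsto_iff_forall_eval_tendsto (B := (topDualPairing ℝ X).flip) (l := atTop)
    (f := fun n => toWeakSpace ℝ X (x n)) (x := toWeakSpace ℝ X 0) ?_
  · refine this.trans (forall_congr' fun g => ?_)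
    have h0 : ((topDualPairing ℝ X).flip (toWeakSpace ℝ X 0)) g = 0 := map_zero g
    rw [h0]
    rfl
  -- The evaluation criterion needs the dual to separate points; Hahn–Banach supplies this.
  · intro a b hab
    by_contra hne
    obtain ⟨g, hg⟩ := SeparatingDual.exists_separating_of_ne (R := ℝ) hne
    exact hg (DFunLike.congr_fun hab g)

variable {X : Type*} [NormedAddCommGroup X] [NormedSpace ℝ X] [Lattice X] [IsOrderedAddMonoid X]
  [IsOrderedModule ℝ X] [HasSolidNorm X]

/-! ### Atoms and their coordinate functionals -/

section Atoms

/-- The disjoint complement of an element. -/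
def disjointComplement (a : X) : Submodule ℝ X where
  carrier := {y | |a| ⊓ |y| = 0}
  zero_mem' := by simp
  add_mem' {y z} hy hz := by
    refine inf_eq_zero_of_le (abs_nonneg a) (abs_nonneg _) le_rfl (abs_add_le y z) ?_
    exact inf_add_eq_zero (abs_nonneg a) (abs_nonneg y) (abs_nonneg z) hy hz
  smul_mem' c y hy := by
    have hy' : |a| ⊓ |y| = 0 := hy
    refine le_antisymm ?_ (le_inf (abs_nonneg _) (abs_nonneg _))
    calc |a| ⊓ |c • y| ≤ |a| ⊓ |c| • |y| := inf_le_inf le_rfl (abs_smul_le c y)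
      _ ≤ (|c| + 1) • (|a| ⊓ |y|) := inf_smul_le (abs_nonneg a) (abs_nonneg y) (abs_nonneg c)
      _ = 0 := by rw [hy', smul_zero]

theorem mem_disjointComplement {a y : X} : y ∈ disjointComplement a ↔ |a| ⊓ |y| = 0 := Iff.rfl

theorem isClosed_disjointComplement (a : X) : IsClosed (disjointComplement a : Set X) := by
  have hc : Continuous fun y : X => |a| ⊓ |y| := by
    simp only [abs]; fun_prop
  exact isClosed_singleton.preimage hc

theorem IsLatticeAtom.exists_smul_of_le {a x : X} (ha : IsLatticeAtom a) (hx : 0 ≤ x)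
    (hxa : x ≤ a) : ∃ c : ℝ, 0 ≤ c ∧ x = c • a := by
  have hmem : x ∈ principalIdeal a := ⟨1, by rwa [one_smul, abs_of_nonneg hx, abs_of_nonneg ha.1]⟩
  rw [ha.2.2] at hmem
  obtain ⟨c, rfl⟩ := hmem
  rcases le_or_gt 0 c with hc | hc
  · exact ⟨c, hc, rfl⟩
  · refine ⟨0, le_rfl, ?_⟩
    rw [zero_smul]
    exact le_antisymm (smul_nonpos_of_nonpos_of_nonneg hc.le ha.1) hx

/-- Take the largest `t` with `t • a ≤ x`. What `a` and `x - t • a` have in common is a multiple `s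
• a` with `s ≥ 0`, and `s > 0` would let `t` grow. -/
theorem IsLatticeAtom.exists_decomposition_of_nonneg {a x : X} (ha : IsLatticeAtom a)
    (hx : 0 ≤ x) : ∃ t : ℝ, x - t • a ∈ disjointComplement a := by
  set S : Set ℝ := {t | t • a ≤ x} with hS
  have hcl : IsClosed S := isClosed_le (by fun_prop) continuous_const
  have h0 : (0 : ℝ) ∈ S := by simpa [hS] using hx
  have hna : 0 < ‖a‖ := norm_pos_iff.2 ha.2.1
  have hbdd : BddAbove S := by
    refine ⟨‖x‖ / ‖a‖, fun t ht => ?_⟩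
    rcases le_or_gt t 0 with h | h
    · exact h.trans (by positivity)
    · rw [le_div_iff₀ hna]
      have := norm_le_norm_of_nonneg_of_le (smul_nonneg h.le ha.1) ht
      rwa [norm_smul, Real.norm_of_nonneg h.le] at this
  have hmem : sSup S ∈ S := hcl.csSup_mem ⟨0, h0⟩ hbdd
  refine ⟨sSup S, ?_⟩
  have hnn : 0 ≤ x - sSup S • a := sub_nonneg.2 hmem
  rw [mem_disjointComplement, abs_of_nonneg ha.1, abs_of_nonneg hnn]
  obtain ⟨s, hs, hs'⟩ := ha.exists_smul_of_le (le_inf ha.1 hnn) inf_le_left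
  have h1 : s • a ≤ x - sSup S • a := hs' ▸ inf_le_right
  have h2 : s + sSup S ∈ S := by
    change (s + sSup S) • a ≤ x
    rw [add_smul]
    exact le_sub_iff_add_le.1 h1
  have h3 : s = 0 := by linarith [le_csSup hbdd h2]
  rw [hs', h3, zero_smul]

theorem IsLatticeAtom.exists_decomposition {a : X} (ha : IsLatticeAtom a) (x : X) :
    ∃ t : ℝ, x - t • a ∈ disjointComplement a := by
  obtain ⟨s, hs⟩ := ha.exists_decomposition_of_nonneg (posPart_nonneg x)
  obtain ⟨t, ht⟩ := ha.exists_decomposition_of_nonneg (negPart_nonneg x)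
  refine ⟨s - t, ?_⟩
  have := Submodule.sub_mem _ hs ht
  convert this using 1
  nth_rw 1 [← posPart_sub_negPart x]
  rw [sub_smul]
  abel

/-- The coordinate functional of an atom. -/
theorem IsLatticeAtom.exists_coordinate {a : X} (ha : IsLatticeAtom a) :
    ∃ g : StrongDual ℝ X, ∀ x, |x| ⊓ a ≤ |g x| • a := by
  have hna : a ∉ disjointComplement a := by
    rw [mem_disjointComplement, inf_idem, abs_of_nonneg ha.1]
    exact ha.2.1
  -- A functional bounded below on a subspace vanishes on it. Once divided by `f a`, it reads off
  -- the coefficient `t` of the decomposition, so linearity and continuity of `t` need no separate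
  -- proof.
  obtain ⟨f, u, hfu, hu⟩ := geometric_hahn_banach_point_closed
    (disjointComplement a).convex (isClosed_disjointComplement a) hna
  have hu0 : u < 0 := by simpa using hu 0 (Submodule.zero_mem _)
  have hf : ∀ y ∈ disjointComplement a, f y = 0 := by
    intro y hy
    by_contra hne
    have := hu ((u / f y) • y) (Submodule.smul_mem _ _ hy)
    rw [map_smul, smul_eq_mul, div_mul_cancel₀ _ hne] at this
    exact lt_irrefl _ this
  have hfa : f a ≠ 0 := (hfu.trans hu0).ne
  refine ⟨(f a)⁻¹ • f, fun x => ?_⟩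
  obtain ⟨t, ht⟩ := ha.exists_decomposition x
  have hgx : ((f a)⁻¹ • f) x = t := by
    have h := hf _ ht
    rw [map_sub, map_smul, smul_eq_mul, sub_eq_zero] at h
    simp [h]
    field_simp
  rw [hgx]
  have ht' : |a| ⊓ |x - t • a| = 0 := ht
  rw [abs_of_nonneg ha.1] at ht'
  have h1 : |x| ≤ |t| • a + |x - t • a| := by
    calc |x| = |t • a + (x - t • a)| := by rw [add_sub_cancel]
      _ ≤ |t • a| + |x - t • a| := abs_add_le _ _
      _ ≤ |t| • a + |x - t • a| := by
        gcongr
        simpa [abs_of_nonneg ha.1] using abs_smul_le t a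
  have hta : 0 ≤ |t| • a := smul_nonneg (abs_nonneg t) ha.1
  calc |x| ⊓ a ≤ a ⊓ (|t| • a + |x - t • a|) := by
        rw [inf_comm]; exact inf_le_inf le_rfl h1
    _ ≤ a ⊓ (|t| • a) + a ⊓ |x - t • a| := inf_add_le_inf_add_inf ha.1 hta (abs_nonneg _)
    _ ≤ |t| • a := by rw [ht', add_zero]; exact inf_le_right

end Atoms

/-! ### Order continuous and atomic implies weakly null sequences are un-null -/

section UnNullIdeal

/-- The elements against which a given sequence is unboundedly norm null. -/
def unNullIdeal (x : ℕ → X) : Submodule ℝ X where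
  carrier := {w | Tendsto (fun n => ‖|x n| ⊓ |w|‖) atTop (𝓝 0)}
  zero_mem' := by simp
  add_mem' {v w} hv hw := by
    refine squeeze_zero (fun n => norm_nonneg _) (fun n => ?_) (by simpa using Tendsto.add hv hw)
    refine (norm_le_norm_of_nonneg_of_le (le_inf (abs_nonneg _) (abs_nonneg _)) ?_).trans
      (norm_add_le _ _)
    exact (inf_le_inf le_rfl (abs_add_le v w)).trans
      (inf_add_le_inf_add_inf (abs_nonneg _) (abs_nonneg _) (abs_nonneg _))
  smul_mem' c w hw := by
    refine squeeze_zero (fun n => norm_nonneg _) (fun n => ?_)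
      (by simpa using Tendsto.const_mul (|c| + 1) hw)
    have h : |x n| ⊓ |c • w| ≤ (|c| + 1) • (|x n| ⊓ |w|) :=
      (inf_le_inf le_rfl (abs_smul_le c w)).trans
        (inf_smul_le (abs_nonneg _) (abs_nonneg _) (abs_nonneg c))
    refine (norm_le_norm_of_nonneg_of_le (le_inf (abs_nonneg _) (abs_nonneg _)) h).trans ?_
    rw [norm_smul, Real.norm_of_nonneg (by positivity)]

theorem mem_unNullIdeal {x : ℕ → X} {w : X} :
    w ∈ unNullIdeal x ↔ Tendsto (fun n => ‖|x n| ⊓ |w|‖) atTop (𝓝 0) := Iff.rfl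

theorem isSolid_unNullIdeal (x : ℕ → X) :
    LatticeOrderedAddCommGroup.IsSolid (unNullIdeal x : Set X) := fun _ hv _ hwv =>
  squeeze_zero (fun _ => norm_nonneg _) (fun _ => norm_le_norm_of_nonneg_of_le
    (le_inf (abs_nonneg _) (abs_nonneg _)) (inf_le_inf le_rfl hwv)) hv

theorem sup_mem_of_isSolid {B : Submodule ℝ X}
    (hB : LatticeOrderedAddCommGroup.IsSolid (B : Set X)) {v w : X} (hv : v ∈ B) (hw : w ∈ B) :
    v ⊔ w ∈ B := by
  have hav : |v| ∈ B := hB hv (abs_abs v).le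
  have haw : |w| ∈ B := hB hw (abs_abs w).le
  refine hB (B.add_mem hav haw) ?_
  rw [abs_of_nonneg (add_nonneg (abs_nonneg v) (abs_nonneg w))]
  refine abs_le'.2 ⟨sup_le ?_ ?_, ?_⟩
  · exact (le_abs_self v).trans (le_add_of_nonneg_right (abs_nonneg w))
  · exact (le_abs_self w).trans (le_add_of_nonneg_left (abs_nonneg v))
  · rw [neg_sup]
    exact inf_le_left.trans ((neg_le_abs v).trans (le_add_of_nonneg_right (abs_nonneg w)))

theorem isBand_unNullIdeal (hX : IsOrderContinuous X) (x : ℕ → X) : IsBand (unNullIdeal x) := by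
  refine ⟨isSolid_unNullIdeal x, fun D w hne hD hw => ?_⟩
  -- `D` need not be directed, so it is replaced by all elements of the ideal below `w`; these are
  -- closed under `⊔` and still have supremum `w`.
  have hlub : IsGLB ((fun y => w - y) '' {y | y ∈ unNullIdeal x ∧ y ≤ w}) 0 := by
    constructor
    · rintro _ ⟨y, hy, rfl⟩
      exact sub_nonneg.2 hy.2
    · intro b hb
      have : w ≤ w - b := hw.2 fun d hd => by
        have := hb ⟨d, ⟨hD hd, hw.1 hd⟩, rfl⟩
        exact le_sub_comm.1 this
      simpa using this
  have hdir : DirectedOn (fun x y => y ≤ x)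
      ((fun y => w - y) '' {y | y ∈ unNullIdeal x ∧ y ≤ w}) := by
    rintro _ ⟨y, hy, rfl⟩ _ ⟨z, hz, rfl⟩
    refine ⟨_, ⟨y ⊔ z, ⟨sup_mem_of_isSolid (isSolid_unNullIdeal x) hy.1 hz.1,
      sup_le hy.2 hz.2⟩, rfl⟩, ?_, ?_⟩
    · exact sub_le_sub_left le_sup_left w
    · exact sub_le_sub_left le_sup_right w
  obtain ⟨d₀, hd₀⟩ := hne
  have hne' : {y | y ∈ unNullIdeal x ∧ y ≤ w}.Nonempty := ⟨d₀, hD hd₀, hw.1 hd₀⟩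
  rw [mem_unNullIdeal, Metric.tendsto_atTop]
  intro ε hε
  obtain ⟨_, ⟨y, hy, rfl⟩, hyε⟩ := hX _ (hne'.image _) hdir hlub
    (ε / 2) (by positivity)
  obtain ⟨N, hN⟩ := Metric.tendsto_atTop.1 (mem_unNullIdeal.1 hy.1) (ε / 2) (by positivity)
  refine ⟨N, fun n hn => ?_⟩
  have h1 := hN n hn
  rw [dist_zero_right, norm_norm] at h1 ⊢
  have h2 : |x n| ⊓ |w| ≤ |x n| ⊓ |y| + |w - y| := by
    have : |w| ≤ |y| + |w - y| := by simpa using abs_add_le y (w - y)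
    exact (inf_le_inf le_rfl this).trans ((inf_add_le_inf_add_inf (abs_nonneg _) (abs_nonneg _)
      (abs_nonneg _)).trans (add_le_add le_rfl inf_le_right))
  have h3 := (norm_le_norm_of_nonneg_of_le (le_inf (abs_nonneg _) (abs_nonneg _)) h2).trans
    (norm_add_le _ _)
  rw [norm_abs_eq_norm] at h3
  simp only at hyε
  linarith

theorem unTendsto_of_weakTendsto (hX : IsOrderContinuous X) (hA : IsAtomicLattice X) {x : ℕ → X}
    (hx : WeakTendsto x atTop 0) : UnTendsto x atTop 0 := by
  have hatoms : {a : X | IsLatticeAtom a} ⊆ unNullIdeal x := by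
    intro a ha
    obtain ⟨g, hg⟩ := IsLatticeAtom.exists_coordinate ha
    have hgx := (weakTendsto_zero_iff.1 hx g).abs.mul_const ‖a‖
    rw [abs_zero, zero_mul] at hgx
    refine squeeze_zero (fun _ => norm_nonneg _) (fun n => ?_) hgx
    rw [abs_of_nonneg ha.1]
    refine (norm_le_norm_of_nonneg_of_le (le_inf (abs_nonneg _) ha.1) (hg (x n))).trans ?_
    rw [norm_smul, Real.norm_of_nonneg (abs_nonneg _)]
  have htop : unNullIdeal x = ⊤ := by
    rw [eq_top_iff, ← hA]
    exact sInf_le ⟨isBand_unNullIdeal hX x, hatoms⟩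
  intro u hu
  have : u ∈ unNullIdeal x := htop ▸ Submodule.mem_top
  simpa [mem_unNullIdeal, abs_of_nonneg hu] using this

end UnNullIdeal

/-! ### From disjoint sequences to increasing sequences -/

section DisjointSequences

/-- Disjoint positive elements have `a + b = a ⊔ b`. -/
theorem sum_le_of_disjoint {e : ℕ → X} {w : X} (hw0 : 0 ≤ w) (h0 : ∀ i, 0 ≤ e i)
    (hw : ∀ i, e i ≤ w) (hd : ∀ i j, i ≠ j → e i ⊓ e j = 0) (s : Finset ℕ) :
    ∑ i ∈ s, e i ≤ w := by
  induction s using Finset.induction_on with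
  | empty => simpa using hw0
  | insert i s hi ih =>
    rw [Finset.sum_insert hi, ← inf_add_sup,
      inf_sum_eq_zero (h0 i) (fun j _ => h0 j) (fun j hj => hd i j (by rintro rfl; exact hi hj)),
      zero_add]
    exact sup_le (hw i) ih

/-- Signed sums of the `e i` have modulus at most `w`, so choosing the signs of `g (e i)` gives `∑
|g (e i)| ≤ ‖g‖ * ‖w‖`. -/
theorem weakTendsto_of_disjoint {e : ℕ → X} {w : X} (h0 : ∀ i, 0 ≤ e i)
    (hw : ∀ i, e i ≤ w) (hd : ∀ i j, i ≠ j → e i ⊓ e j = 0) : WeakTendsto e atTop 0 := by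
  have hw0 : 0 ≤ w := (h0 0).trans (hw 0)
  refine weakTendsto_zero_iff.2 fun g => ?_
  have hsum : Summable fun i => |g (e i)| := by
    refine summable_of_sum_le (c := ‖g‖ * ‖w‖) (fun i => abs_nonneg _) fun s => ?_
    have h1 : ∑ i ∈ s, |g (e i)| = g (∑ i ∈ s, (SignType.sign (g (e i)) : ℝ) • e i) := by
      rw [map_sum]
      refine Finset.sum_congr rfl fun i _ => ?_
      rcases lt_trichotomy (g (e i)) 0 with h | h | h
      · simp [h, abs_of_neg h]
      · simp [h]
      · simp [h, abs_of_pos h]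
    have h2 : |∑ i ∈ s, (SignType.sign (g (e i)) : ℝ) • e i| ≤ |w| := by
      rw [abs_of_nonneg hw0]
      refine (abs_sum_le_sum (y := e) fun i _ => ?_).trans (sum_le_of_disjoint hw0 h0 hw hd s)
      rcases lt_trichotomy (g (e i)) 0 with h | h | h
      · simp [h, abs_of_nonneg (h0 i)]
      · simp [h, h0 i]
      · simp [h, abs_of_nonneg (h0 i)]
    rw [h1]
    exact (le_abs_self _).trans ((g.le_opNorm _).trans
      (mul_le_mul_of_nonneg_left (norm_le_norm_of_abs_le_abs h2) (norm_nonneg g)))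
  exact (tendsto_zero_iff_abs_tendsto_zero _).2 hsum.tendsto_atTop_zero

variable (X) in
/-- Order bounded disjoint sequences are norm null. -/
def DisjointNull : Prop :=
  ∀ (e : ℕ → X) (w : X), (∀ i, 0 ≤ e i) → (∀ i, e i ≤ w) → (∀ i j, i ≠ j → e i ⊓ e j = 0) →
    Tendsto (fun i => ‖e i‖) atTop (𝓝 0)

variable (X) in
/-- Order bounded increasing sequences are norm Cauchy. -/
def MonotoneCauchy : Prop :=
  ∀ (x : ℕ → X) (u : X), Monotone x → (∀ n, x n ≤ u) → CauchySeq x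

theorem norm_tendsto_of_unTendsto {x : ℕ → X} {u : X} (hu : ∀ n, |x n| ≤ u)
    (hx : UnTendsto x atTop 0) : Tendsto (fun n => ‖x n‖) atTop (𝓝 0) := by
  have h := hx u ((abs_nonneg _).trans (hu 0))
  refine h.congr fun n => ?_
  rw [sub_zero, inf_eq_left.2 (hu n), norm_abs_eq_norm]

theorem disjointNull_of_weak_imp_un
    (h : ∀ x : ℕ → X, WeakTendsto x atTop 0 → UnTendsto x atTop 0) : DisjointNull X :=
  fun e w h0 hw hd => norm_tendsto_of_unTendsto (u := w)
    (fun n => by rw [abs_of_nonneg (h0 n)]; exact hw n) (h e (weakTendsto_of_disjoint h0 hw hd))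

theorem exists_subsequence_norm_inf_le {e : ℕ → X}
    (h : ∀ i, Tendsto (fun j => ‖e i ⊓ e j‖) atTop (𝓝 0)) {δ : ℝ} (hδ : 0 < δ) :
    ∃ φ : ℕ → ℕ, ∀ i j, i ≠ j → ‖e (φ i) ⊓ e (φ j)‖ ≤ δ * (1 / 2) ^ i * (1 / 2) ^ j := by
  -- Pairs are (index, level). Each new level exceeds all earlier ones, so it is at least the
  -- position `j`, and `4⁻ʲ ≤ 2⁻ⁱ 2⁻ʲ` for `i < j`.
  obtain ⟨f, -, hf⟩ := exists_seq_of_forall_finset_exists (fun _ : ℕ × ℕ => True)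
    (fun p q => p.2 < q.2 ∧ ‖e p.1 ⊓ e q.1‖ ≤ δ * (1 / 4) ^ q.2) (fun s _ => by
      set l := s.sup Prod.snd + 1
      have hev : ∀ᶠ j in atTop, ∀ p ∈ s, ‖e p.1 ⊓ e j‖ ≤ δ * (1 / 4) ^ l := by
        rw [Filter.eventually_all_finset]
        intro p _
        exact (h p.1).eventually (eventually_le_nhds (by positivity))
      obtain ⟨j, hj⟩ := hev.exists
      exact ⟨(j, l), trivial, fun p hp =>
        ⟨Nat.lt_succ_of_le (Finset.le_sup (f := Prod.snd) hp), hj p hp⟩⟩)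
  have hmono : StrictMono fun n => (f n).2 := fun m n hmn => (hf m n hmn).1
  have key : ∀ i j, i < j → ‖e (f i).1 ⊓ e (f j).1‖ ≤ δ * (1 / 2) ^ i * (1 / 2) ^ j := by
    intro i j hij
    refine (hf i j hij).2.trans ?_
    have h1 : ((1 : ℝ) / 4) ^ (f j).2 ≤ (1 / 4) ^ j :=
      pow_le_pow_of_le_one (by norm_num) (by norm_num) (hmono.le_apply)
    have h2 : ((1 : ℝ) / 4) ^ j = (1 / 2) ^ j * (1 / 2) ^ j := by
      rw [← mul_pow]; norm_num
    have h3 : ((1 : ℝ) / 2) ^ j ≤ (1 / 2) ^ i :=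
      pow_le_pow_of_le_one (by norm_num) (by norm_num) hij.le
    rw [mul_assoc]
    gcongr
    calc _ ≤ _ := h1
      _ = _ := h2
      _ ≤ _ := by gcongr
  refine ⟨fun n => (f n).1, fun i j hij => ?_⟩
  rcases lt_or_gt_of_ne hij with h | h
  · exact key i j h
  · rw [inf_comm, mul_right_comm]
    exact key j i h

/-- Subtracting from `a i` the sum `s i` of all its overlaps costs at most `δ / 2` in norm. It
leaves `(a i - s i)⁺ ≤ (a i - a j)⁺`, so distinct remainders are disjoint. -/
theorem DisjointNull.false_of_small_inf [CompleteSpace X] (hX : DisjointNull X) {a : ℕ → X} {w : X}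
    {δ : ℝ} (hδ : 0 < δ) (h0 : ∀ i, 0 ≤ a i) (hw : ∀ i, a i ≤ w) (hn : ∀ i, δ ≤ ‖a i‖)
    (hs : ∀ i j, i ≠ j → ‖a i ⊓ a j‖ ≤ δ / 4 * (1 / 2) ^ i * (1 / 2) ^ j) : False := by
  set b : ℕ → ℕ → X := fun i j => if i = j then 0 else a i ⊓ a j with hb
  have hb0 : ∀ i j, 0 ≤ b i j := fun i j => by
    by_cases hij : i = j
    · simp [hb, hij]
    · simpa [hb, hij] using ⟨h0 i, h0 j⟩
  have hbn : ∀ i j, ‖b i j‖ ≤ δ / 4 * (1 / 2) ^ i * (1 / 2) ^ j := fun i j => by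
    by_cases hij : i = j
    · simp only [hb, hij, if_true, norm_zero]; positivity
    · simpa only [hb, hij, if_false] using hs i j hij
  have hgeo : ∀ i : ℕ, HasSum (fun j : ℕ => δ / 4 * (1 / 2) ^ i * (1 / 2) ^ j)
      (δ / 4 * (1 / 2) ^ i * 2) := fun i => hasSum_geometric_two.mul_left _
  have hsum : ∀ i, Summable (b i) := fun i => Summable.of_norm_bounded (hgeo i).summable (hbn i)
  set s : ℕ → X := fun i => ∑' j, b i j with hsdef
  have hs0 : ∀ i, 0 ≤ s i := fun i => tsum_nonneg (hb0 i)
  have hsn : ∀ i, ‖s i‖ ≤ δ / 2 := fun i => by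
    refine (tsum_of_norm_bounded (hgeo i) (hbn i)).trans ?_
    have : ((1 : ℝ) / 2) ^ i ≤ 1 := pow_le_one₀ (by norm_num) (by norm_num)
    nlinarith
  have hsle : ∀ i j, i ≠ j → a i ⊓ a j ≤ s i := fun i j hij => by
    have := (hsum i).le_tsum j fun k _ => hb0 i k
    simpa [hb, hij] using this
  have hpos : ∀ i j, i ≠ j → (a i - s i)⁺ ≤ (a i - a j)⁺ := fun i j hij => by
    have h1 : a i - s i ≤ (a i - a j)⁺ := by
      refine (sub_le_sub_left (hsle i j hij) _).trans ?_
      rw [sub_inf, sub_self, sup_comm]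
      rfl
    exact sup_le h1 (posPart_nonneg _)
  have hlim := hX (fun i => (a i - s i)⁺) w (fun i => posPart_nonneg _)
    (fun i => sup_le ((sub_le_self _ (hs0 i)).trans (hw i)) ((h0 0).trans (hw 0)))
    (fun i j hij => by
      refine inf_eq_zero_of_le (posPart_nonneg _) (posPart_nonneg _) (hpos i j hij)
        (hpos j i hij.symm) ?_
      have := posPart_inf_negPart_eq_zero (a i - a j)
      rwa [← posPart_neg, neg_sub] at this)
  have hge : ∀ i, δ / 2 ≤ ‖(a i - s i)⁺‖ := fun i => by
    have h1 : a i ≤ (a i - s i)⁺ + s i := sub_le_iff_le_add.1 (le_posPart _)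
    have h2 := (norm_le_norm_of_nonneg_of_le (h0 i) h1).trans (norm_add_le _ _)
    linarith [hn i, hsn i]
  have := ge_of_tendsto' hlim hge
  linarith

/-- Induction on the overlap number. Either every `e i ⊓ e j` tends to `0` in `j`, and a subsequence
is almost disjoint; or some `e i` meets infinitely many `e j` in norm at least `η`, and these meets
have smaller overlap number. -/
theorem DisjointNull.false_of_overlap [CompleteSpace X] (hX : DisjointNull X) {w : X} (m : ℕ) :
    ∀ (e : ℕ → X) (δ : ℝ), 0 < δ → (∀ i, 0 ≤ e i) → (∀ i, e i ≤ w) → (∀ i, δ ≤ ‖e i‖) →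
      (∀ F : Finset ℕ, F.card = m + 1 → ∀ z, (∀ i ∈ F, z ≤ e i) → z ≤ 0) → False := by
  induction m with
  | zero =>
    intro e δ hδ h0 hw hn hF
    have h1 : e 0 = 0 := le_antisymm (hF {0} rfl (e 0) (by simp)) (h0 0)
    have h2 := hn 0
    rw [h1, norm_zero] at h2
    linarith
  | succ m ih =>
    intro e δ hδ h0 hw hn hF
    by_cases hA : ∀ i, Tendsto (fun j => ‖e i ⊓ e j‖) atTop (𝓝 0)
    · obtain ⟨φ, hφ⟩ := exists_subsequence_norm_inf_le hA (δ := δ / 4) (by positivity)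
      exact hX.false_of_small_inf hδ (fun i => h0 (φ i)) (fun i => hw (φ i)) (fun i => hn (φ i)) hφ
    · push Not at hA
      obtain ⟨i, hi⟩ := hA
      rw [Metric.tendsto_atTop] at hi
      push Not at hi
      obtain ⟨η, hη, hi⟩ := hi
      -- Requiring `i < j` keeps `i` out of the subsequence, so adjoining it to a finite index set
      -- raises the cardinality by one.
      have hfr : ∃ᶠ j in atTop, i < j ∧ η ≤ ‖e i ⊓ e j‖ := by
        rw [frequently_atTop]
        intro N
        obtain ⟨n, hn, hn'⟩ := hi (max N (i + 1))
        refine ⟨n, (le_max_left _ _).trans hn, (le_max_right _ _).trans hn, ?_⟩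
        simpa using hn'
      obtain ⟨φ, hφ, hφ'⟩ := extraction_of_frequently_atTop hfr
      refine ih (fun j => e i ⊓ e (φ j)) η hη (fun j => le_inf (h0 i) (h0 _))
        (fun j => inf_le_left.trans (hw i)) (fun j => (hφ' j).2) fun F hFc z hz => ?_
      have hni : i ∉ F.map ⟨φ, hφ.injective⟩ := by
        simp only [Finset.mem_map, Function.Embedding.coeFn_mk, not_exists, not_and]
        exact fun j _ hj => (hφ' j).1.ne' hj
      obtain ⟨k, hk⟩ : F.Nonempty := Finset.card_pos.1 (by omega)
      refine hF (insert i (F.map ⟨φ, hφ.injective⟩)) (by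
        rw [Finset.card_insert_of_notMem hni, Finset.card_map, hFc]) z fun j hj => ?_
      rcases Finset.mem_insert.1 hj with rfl | hj
      · exact (hz k hk).trans inf_le_left
      · obtain ⟨l, hl, rfl⟩ := Finset.mem_map.1 hj
        exact (hz l hl).trans inf_le_right

/-- `z` is disjoint from every `(v i)⁻`, hence from their sum. That sum dominates `∑ (v i)⁺ ≥ z`, so
`z` is disjoint from itself. -/
theorem eq_zero_of_le_posPart_of_sum_nonpos {F : Finset ℕ} {v : ℕ → X} {z : X} (hF : F.Nonempty)
    (hz : 0 ≤ z) (hzv : ∀ i ∈ F, z ≤ (v i)⁺) (hv : ∑ i ∈ F, v i ≤ 0) : z = 0 := by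
  have h1 : ∑ i ∈ F, (v i)⁺ ≤ ∑ i ∈ F, (v i)⁻ := by
    rw [← sub_nonpos, ← Finset.sum_sub_distrib]
    simpa only [posPart_sub_negPart] using hv
  have h2 : z ⊓ ∑ i ∈ F, (v i)⁻ = 0 := inf_sum_eq_zero hz (fun i _ => negPart_nonneg _)
    fun i hi => inf_eq_zero_of_le hz (negPart_nonneg _) (hzv i hi) le_rfl
      (posPart_inf_negPart_eq_zero _)
  obtain ⟨k, hk⟩ := hF
  have h3 : z ≤ ∑ i ∈ F, (v i)⁻ := (hzv k hk).trans
    ((Finset.single_le_sum (f := fun i => (v i)⁺) (fun i _ => posPart_nonneg _) hk).trans h1)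
  rwa [inf_eq_left.2 h3] at h2

/-- Truncation creates finite overlap: for `t = 1 / (k + 1)`, any `k + 1` of the elements `d i - t •
w` sum to at most `w - w = 0`. Taking `k > 2 * ‖w‖ / δ` keeps the norms of `(d i - t • w)⁺` above `δ
/ 2`. -/
theorem DisjointNull.false_of_sum_le [CompleteSpace X] (hX : DisjointNull X) {d : ℕ → X} {w : X}
    {δ : ℝ} (hδ : 0 < δ) (h0 : ∀ i, 0 ≤ d i) (hn : ∀ i, δ ≤ ‖d i‖)
    (hs : ∀ F : Finset ℕ, ∑ i ∈ F, d i ≤ w) : False := by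
  have hw0 : 0 ≤ w := by simpa using hs ∅
  have hdw : ∀ i, d i ≤ w := fun i => by simpa using hs {i}
  obtain ⟨k, hk⟩ := exists_nat_gt (2 * ‖w‖ / δ)
  have hk' : (0 : ℝ) < k + 1 := by positivity
  set t : ℝ := ((k : ℝ) + 1)⁻¹ with ht
  have ht0 : 0 < t := inv_pos.2 hk'
  have htw : ‖t • w‖ ≤ δ / 2 := by
    rw [norm_smul, Real.norm_of_nonneg ht0.le, ht, inv_mul_le_iff₀ hk']
    rw [div_lt_iff₀ hδ] at hk
    nlinarith
  have htw0 : 0 ≤ t • w := smul_nonneg ht0.le hw0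
  refine hX.false_of_overlap (w := w) k (fun i => (d i - t • w)⁺) (δ / 2) (by positivity)
    (fun i => posPart_nonneg _) (fun i => sup_le ((sub_le_self _ htw0).trans (hdw i)) hw0)
    (fun i => ?_) fun F hF z hz => ?_
  · have h1 : d i ≤ (d i - t • w)⁺ + t • w := sub_le_iff_le_add.1 (le_posPart _)
    have h2 := (norm_le_norm_of_nonneg_of_le (h0 i) h1).trans (norm_add_le _ _)
    linarith [hn i]
  · have : z⁺ = 0 := by
      refine eq_zero_of_le_posPart_of_sum_nonpos (v := fun i => d i - t • w)
        (Finset.card_pos.1 (by omega : 0 < F.card)) (posPart_nonneg z)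
        (fun i hi => sup_le (hz i hi) (posPart_nonneg _)) ?_
      rw [Finset.sum_sub_distrib, Finset.sum_const, hF, ← Nat.cast_smul_eq_nsmul ℝ, smul_smul]
      have : ((k + 1 : ℕ) : ℝ) * t = 1 := by
        rw [ht]; push_cast; exact mul_inv_cancel₀ hk'.ne'
      rw [this, one_smul]
      exact sub_nonpos.2 (hs F)
    exact posPart_eq_zero.1 this

theorem DisjointNull.monotoneCauchy [CompleteSpace X] (hX : DisjointNull X) :
    MonotoneCauchy X := by
  intro x u hx hu
  by_contra hc
  rw [Metric.cauchySeq_iff'] at hc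
  push Not at hc
  obtain ⟨ε, hε, hc⟩ := hc
  choose next hnext hnext' using hc
  set φ : ℕ → ℕ := fun k => next^[k] 0 with hφ
  have hφs : ∀ k, φ (k + 1) = next (φ k) := fun k => Function.iterate_succ_apply' _ _ _
  have hφm : Monotone φ := monotone_nat_of_le_succ fun k => by rw [hφs]; exact hnext _
  have h0 : ∀ k, 0 ≤ x (φ (k + 1)) - x (φ k) := fun k =>
    sub_nonneg.2 (hx (hφm (Nat.le_succ k)))
  refine hX.false_of_sum_le (d := fun k => x (φ (k + 1)) - x (φ k)) (w := u - x (φ 0)) hε h0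
    (fun k => ?_) fun F => ?_
  · rw [hφs, ← dist_eq_norm]
    exact hnext' (φ k)
  · obtain ⟨N, hN⟩ := F.exists_nat_subset_range
    calc ∑ i ∈ F, (x (φ (i + 1)) - x (φ i))
        ≤ ∑ i ∈ Finset.range N, (x (φ (i + 1)) - x (φ i)) :=
          Finset.sum_le_sum_of_subset_of_nonneg hN fun i _ _ => h0 i
      _ = x (φ N) - x (φ 0) := Finset.sum_range_sub (fun i => x (φ i)) N
      _ ≤ u - x (φ 0) := sub_le_sub_right (hu _) _

end DisjointSequences

/-! ### Suprema of directed sets as norm limits -/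

section Suprema

/-- Otherwise iterating a large increment gives a bounded increasing sequence that is not Cauchy. -/
theorem MonotoneCauchy.exists_small_increment (hX : MonotoneCauchy X) {D : Set X} {u : X}
    (hne : D.Nonempty) (hu : u ∈ upperBounds D) {ε : ℝ} (hε : 0 < ε) :
    ∃ d ∈ D, ∀ d' ∈ D, d ≤ d' → ‖d' - d‖ < ε := by
  by_contra! hc
  choose! next hnext hle hge using hc
  obtain ⟨d₀, hd₀⟩ := hne
  set x : ℕ → X := fun k => next^[k] d₀ with hx
  have hs : ∀ k, x (k + 1) = next (x k) := fun k => Function.iterate_succ_apply' _ _ _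
  have hmem : ∀ k, x k ∈ D := fun k => by
    induction k with
    | zero => exact hd₀
    | succ k ih => rw [hs]; exact hnext _ ih
  have hm : Monotone x := monotone_nat_of_le_succ fun k => by rw [hs]; exact hle _ (hmem k)
  obtain ⟨N, hN⟩ := Metric.cauchySeq_iff'.1 (hX x u hm fun k => hu (hmem k)) ε hε
  have h := hN (N + 1) (Nat.le_succ N)
  rw [dist_eq_norm, hs] at h
  exact absurd h (not_lt.2 (hge _ (hmem N)))

/-- A nonempty upward directed set that is bounded above has a supremum, which is a norm limit. -/
theorem MonotoneCauchy.exists_isLUB [CompleteSpace X] (hX : MonotoneCauchy X) {D : Set X} {u : X}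
    (hne : D.Nonempty) (hdir : DirectedOn (· ≤ ·) D) (hu : u ∈ upperBounds D) :
    ∃ x ∈ closure D, IsLUB D x := by
  choose d hd hd' using fun n : ℕ => hX.exists_small_increment hne hu
    (show (0 : ℝ) < (1 / 2) ^ n by positivity)
  choose! ub hub hubl hubr using hdir
  let e : ℕ → X := fun n => Nat.rec (d 0) (fun k y => ub y (d (k + 1))) n
  have heD : ∀ n, e n ∈ D := fun n => by
    induction n with
    | zero => exact hd 0
    | succ k ih => exact hub _ ih _ (hd _)
  have hem : Monotone e := monotone_nat_of_le_succ fun k => hubl _ (heD k) _ (hd _)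
  have hde : ∀ n, d n ≤ e n := fun n => by
    cases n with
    | zero => exact le_rfl
    | succ k => exact hubr _ (heD k) _ (hd _)
  obtain ⟨x, hx⟩ := cauchySeq_tendsto_of_complete (hX e u hem fun k => hu (heD k))
  refine ⟨x, mem_closure_of_tendsto hx (Eventually.of_forall heD), fun y hy => ?_, fun b hb =>
    le_of_tendsto' hx fun n => hb (heD n)⟩
  have hex : ∀ n, e n ≤ x := hem.ge_of_tendsto hx
  -- Any member of `D` above both `y` and `e n` lies within `2⁻ⁿ` of `d n`, while `d n ≤ x`; hence
  -- `y` exceeds `x` by at most `2⁻ⁿ` in norm.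
  have hle : ∀ n : ℕ, ‖(y - x)⁺‖ ≤ (1 / 2) ^ n := fun n => by
    have hz := hub _ hy _ (heD n)
    have h1 : (y - x)⁺ ≤ ub y (e n) - d n := by
      refine sup_le (sub_le_sub (hubl _ hy _ (heD n)) ((hde n).trans (hex n))) ?_
      exact sub_nonneg.2 ((hde n).trans (hubr _ hy _ (heD n)))
    exact (norm_le_norm_of_nonneg_of_le (posPart_nonneg _) h1).trans
      (hd' n _ hz ((hde n).trans (hubr _ hy _ (heD n)))).le
  have h0 : ‖(y - x)⁺‖ ≤ 0 :=
    ge_of_tendsto' (tendsto_pow_atTop_nhds_zero_of_lt_one (by norm_num) (by norm_num)) hle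
  exact sub_nonpos.1 (posPart_eq_zero.1 (norm_le_zero_iff.1 h0))

theorem MonotoneCauchy.isOrderContinuous [CompleteSpace X] (hX : MonotoneCauchy X) :
    IsOrderContinuous X := by
  intro D hne hdir hD ε hε
  have hlub : IsLUB (-D) 0 := by simpa using hD.neg
  obtain ⟨x, hx, hx'⟩ := hX.exists_isLUB (D := -D) (by simpa using hne) (fun x hx y hy => by
    obtain ⟨z, hz, hzx, hzy⟩ := hdir (-x) hx (-y) hy
    exact ⟨-z, by simpa using hz, le_neg.1 hzx, le_neg.1 hzy⟩) hlub.1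
  rw [hx'.unique hlub] at hx
  obtain ⟨y, hy, hyε⟩ := Metric.mem_closure_iff.1 hx ε hε
  exact ⟨-y, hy, by simpa using hyε⟩

end Suprema

/-! ### Elements without atoms, strictly positive functionals -/

section Functionals

theorem isBand_bandGenerated (S : Set X) : IsBand (bandGenerated S) := by
  refine ⟨fun x hx y hxy => ?_, fun D x hne hD hx => ?_⟩
  · exact Submodule.mem_sInf.2 fun B hB => hB.1.1 (Submodule.mem_sInf.1 hx B hB) hxy
  · exact Submodule.mem_sInf.2 fun B hB =>
      hB.1.2 D x hne (fun d hd => Submodule.mem_sInf.1 (hD hd) B hB) hx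

theorem subset_bandGenerated (S : Set X) : S ⊆ bandGenerated S := fun _ hx =>
  Submodule.mem_sInf.2 fun _ hB => hB.2 hx

/-- Remove from some `|x|` outside the band its largest minorant `b` in the band. An atom below `|x|
- b` could be added to `b`. -/
theorem MonotoneCauchy.exists_no_atoms_below [CompleteSpace X] (hX : MonotoneCauchy X)
    (hA : ¬ IsAtomicLattice X) : ∃ e : X, 0 ≤ e ∧ e ≠ 0 ∧ ∀ a ≤ e, ¬ IsLatticeAtom a := by
  set B : Submodule ℝ X := bandGenerated {a : X | IsLatticeAtom a} with hBdef
  have hB : IsBand B := isBand_bandGenerated _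
  obtain ⟨x, hx⟩ : ∃ x, x ∉ B := by
    by_contra! h
    exact hA (eq_top_iff.2 fun x _ => h x)
  have hx' : |x| ∉ B := fun h => hx (hB.1 h (abs_abs x).ge)
  obtain ⟨b, -, hb⟩ := hX.exists_isLUB (D := {b | b ∈ B ∧ b ≤ |x|}) (u := |x|)
    ⟨0, B.zero_mem, abs_nonneg x⟩
    (fun y hy z hz => ⟨y ⊔ z, ⟨sup_mem_of_isSolid hB.1 hy.1 hz.1, sup_le hy.2 hz.2⟩,
      le_sup_left, le_sup_right⟩) (fun y hy => hy.2)
  have hbB : b ∈ B := hB.2 {b | b ∈ B ∧ b ≤ |x|} b ⟨0, B.zero_mem, abs_nonneg x⟩ (fun y hy => hy.1) hb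
  have hbx : b ≤ |x| := hb.2 fun y hy => hy.2
  refine ⟨|x| - b, sub_nonneg.2 hbx, fun h => hx' (by rwa [sub_eq_zero.1 h]), fun a ha hat => ?_⟩
  have h1 : b + a ≤ b :=
    hb.1 ⟨B.add_mem hbB (subset_bandGenerated _ hat), by rwa [add_comm, ← le_sub_iff_add_le]⟩
  exact hat.2.1 (le_antisymm (by simpa using h1) hat.1)

/-- Separate `-e` from the closed positive cone; a functional bounded below on a cone is nonnegative
there. -/
theorem exists_positive_functional {e : X} (he : 0 ≤ e) (hne : e ≠ 0) :
    ∃ f : StrongDual ℝ X, (∀ x, 0 ≤ x → 0 ≤ f x) ∧ 0 < f e := by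
  have hconv : Convex ℝ {x : X | 0 ≤ x} := by
    intro x hx y hy a b ha hb _
    exact add_nonneg (smul_nonneg ha hx) (smul_nonneg hb hy)
  have hnot : -e ∉ {x : X | 0 ≤ x} := fun h => hne (le_antisymm (neg_nonneg.1 h) he)
  obtain ⟨f, u, hfu, hu⟩ := geometric_hahn_banach_point_closed hconv isClosed_nonneg hnot
  have hu0 : u < 0 := by simpa using hu 0 le_rfl
  refine ⟨f, fun x hx => ?_, ?_⟩
  · by_contra! hneg
    have := hu ((u / f x) • x) (smul_nonneg (div_nonneg_of_nonpos hu0.le hneg.le) hx)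
    rw [map_smul, smul_eq_mul, div_mul_cancel₀ _ hneg.ne] at this
    exact lt_irrefl _ this
  · rw [map_neg] at hfu
    linarith

/-- A positive functional that is strictly positive on the order interval `[0, e]`. -/
structure StrictlyPositiveOn (f : StrongDual ℝ X) (e : X) : Prop where
  nonneg : ∀ x, 0 ≤ x → 0 ≤ f x
  eq_zero : ∀ x, 0 ≤ x → x ≤ e → f x = 0 → x = 0

theorem StrictlyPositiveOn.mono {f : StrongDual ℝ X} {e : X} (hf : StrictlyPositiveOn f e)
    {x y : X} (h : x ≤ y) : f x ≤ f y := by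
  have := hf.nonneg (y - x) (sub_nonneg.2 h)
  rwa [map_sub, sub_nonneg] at this

/-- The elements of `[0, e]` killed by `f` form a closed directed set, so there is a largest one,
`b`; take `e' = e - b`. -/
theorem MonotoneCauchy.exists_strictlyPositiveOn [CompleteSpace X] (hX : MonotoneCauchy X) {e : X}
    (he : 0 ≤ e) (hne : e ≠ 0) : ∃ (f : StrongDual ℝ X) (e' : X), 0 ≤ e' ∧ e' ≤ e ∧ e' ≠ 0 ∧
      StrictlyPositiveOn f e' := by
  obtain ⟨f, hf, hfe⟩ := exists_positive_functional he hne
  set D : Set X := {x | 0 ≤ x ∧ x ≤ e ∧ f x = 0} with hD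
  obtain ⟨b, hbc, hb⟩ := hX.exists_isLUB (D := D) (u := e) ⟨0, le_rfl, he, map_zero f⟩
    (fun y hy z hz => ⟨y ⊔ z, ⟨hy.1.trans le_sup_left, sup_le hy.2.1 hz.2.1, by
      have h1 := hf (y ⊔ z) (hy.1.trans le_sup_left)
      have h2 : y ⊔ z ≤ y + z :=
        sup_le (le_add_of_nonneg_right hz.1) (le_add_of_nonneg_left hy.1)
      have h3 := hf _ (sub_nonneg.2 h2)
      rw [map_sub, map_add, hy.2.2, hz.2.2] at h3
      linarith⟩, le_sup_left, le_sup_right⟩) (fun y hy => hy.2.1)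
  have hDc : IsClosed D := (isClosed_le continuous_const continuous_id).inter
    ((isClosed_le continuous_id continuous_const).inter
      (isClosed_eq f.continuous continuous_const))
  rw [hDc.closure_eq] at hbc
  refine ⟨f, e - b, sub_nonneg.2 hbc.2.1, sub_le_self _ hbc.1, fun h => ?_, hf,
    fun x hx hxe hfx => ?_⟩
  · rw [sub_eq_zero.1 h, hbc.2.2] at hfe
    exact lt_irrefl _ hfe
  · have h1 : b + x ≤ b := hb.1 ⟨add_nonneg hbc.1 hx, by rwa [add_comm, ← le_sub_iff_add_le],
      by rw [map_add, hbc.2.2, hfx, add_zero]⟩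
    exact le_antisymm (by simpa using h1) hx

theorem StrictlyPositiveOn.apply_partialSups_le {f : StrongDual ℝ X} {e : X}
    (hf : StrictlyPositiveOn f e) {x : ℕ → X} (hx : ∀ n, 0 ≤ x n) (n : ℕ) :
    f (partialSups x n) ≤ ∑ i ∈ Finset.range (n + 1), f (x i) := by
  induction n with
  | zero => simp
  | succ n ih =>
    have h0 : 0 ≤ partialSups x n := (hx n).trans (le_partialSups x n)
    rw [partialSups_add_one, Finset.sum_range_succ]
    have h2 : partialSups x n ⊔ x (n + 1) ≤ partialSups x n + x (n + 1) :=
      sup_le (le_add_of_nonneg_right (hx _)) (le_add_of_nonneg_left h0)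
    refine (hf.mono h2).trans ?_
    rw [map_add]
    gcongr

/-- On `[0, e]`, the norm is absolutely continuous with respect to `f`. -/
theorem StrictlyPositiveOn.exists_norm_lt [CompleteSpace X] (hX : MonotoneCauchy X)
    {f : StrongDual ℝ X} {e : X} (hf : StrictlyPositiveOn f e) {ε : ℝ} (hε : 0 < ε) :
    ∃ δ > 0, ∀ x, 0 ≤ x → x ≤ e → f x < δ → ‖x‖ < ε := by
  by_contra! hc
  choose x hx0 hxe hfx hxε using fun n : ℕ => hc ((1 / 2) ^ n) (by positivity)
  -- A Borel–Cantelli argument: `y n` is the supremum of the tail `x k`, `k ≥ n`, so `f (y n) ≤ 2 *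
  -- 2⁻ⁿ`. The decreasing `y n` converge to a point of `[0, e]` where `f` vanishes, that is to `0`,
  -- although `‖y n‖ ≥ ‖x n‖ ≥ ε`.
  have hlim : ∀ n, ∃ y, Tendsto (fun m => partialSups (fun k => x (n + k)) m) atTop (𝓝 y) :=
    fun n => cauchySeq_tendsto_of_complete
      (hX _ e (partialSups _).monotone fun m => partialSups_le _ _ _ fun k _ => hxe (n + k))
  choose y hy using hlim
  have hyle : ∀ n m, partialSups (fun k => x (n + k)) m ≤ y n := fun n m =>
    (partialSups _).monotone.ge_of_tendsto (hy n) m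
  have hxy : ∀ n k, n ≤ k → x k ≤ y n := fun n k hk => by
    obtain ⟨j, rfl⟩ := Nat.exists_eq_add_of_le hk
    exact (le_partialSups (fun k => x (n + k)) j).trans (hyle n j)
  have hye : ∀ n, y n ≤ e := fun n =>
    le_of_tendsto' (hy n) fun m => partialSups_le _ _ _ fun k _ => hxe (n + k)
  have hanti : ∀ n, y (n + 1) ≤ y n := fun n =>
    le_of_tendsto' (hy (n + 1)) fun m => partialSups_le _ _ _ fun k _ => hxy n _ (by omega)
  have hfy : ∀ n, f (y n) ≤ (1 / 2) ^ n * 2 := fun n => by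
    refine le_of_tendsto' ((f.continuous.tendsto _).comp (hy n)) fun m => ?_
    refine (hf.apply_partialSups_le (fun k => hx0 (n + k)) m).trans ?_
    refine (Finset.sum_le_sum fun i _ => (hfx (n + i)).le).trans ?_
    simp_rw [pow_add]
    exact sum_le_hasSum _ (fun i _ => by positivity) (hasSum_geometric_two.mul_left _)
  have hy0 : ∀ n, 0 ≤ y n := fun n => (hx0 n).trans (hxy n n le_rfl)
  obtain ⟨z, hz⟩ := cauchySeq_tendsto_of_complete (hX (fun n => -y n) 0
    (monotone_nat_of_le_succ fun n => neg_le_neg (hanti n)) fun n => neg_nonpos.2 (hy0 n))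
  have hyz : Tendsto y atTop (𝓝 (-z)) := by simpa using hz.neg
  have hz0 : -z = 0 := by
    have hnn : 0 ≤ -z := ge_of_tendsto' hyz hy0
    refine hf.eq_zero _ hnn (le_of_tendsto' hyz hye) (le_antisymm ?_ (hf.nonneg _ hnn))
    refine le_of_tendsto_of_tendsto' ((f.continuous.tendsto _).comp hyz)
      (by simpa using (tendsto_pow_atTop_nhds_zero_of_lt_one (r := (1 / 2 : ℝ)) (by norm_num)
        (by norm_num)).mul_const 2) hfy
  rw [hz0] at hyz
  have hn : Tendsto (fun n => ‖y n‖) atTop (𝓝 0) := by simpa using hyz.norm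
  have := ge_of_tendsto' hn fun n =>
    (hxε n).trans (norm_le_norm_of_nonneg_of_le (hx0 n) (hxy n n le_rfl))
  linarith

end Functionals

/-! ### Components and exact halving -/

section Components

/-- `q` is a component of `p`: it is disjoint from `p - q`. -/
def IsComponent (q p : X) : Prop := q ⊓ (p - q) = 0

theorem IsComponent.nonneg {q p : X} (h : IsComponent q p) : 0 ≤ q := h.ge.trans inf_le_left

theorem IsComponent.le {q p : X} (h : IsComponent q p) : q ≤ p :=
  sub_nonneg.1 (h.ge.trans inf_le_right)

theorem IsComponent.compl {q p : X} (h : IsComponent q p) : IsComponent (p - q) p := by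
  rwa [IsComponent, sub_sub_cancel, inf_comm]

theorem IsComponent.trans {r q p : X} (h : IsComponent r q) (h' : IsComponent q p) :
    IsComponent r p := by
  have h1 : r ⊓ (p - q) = 0 :=
    inf_eq_zero_of_le h.nonneg (sub_nonneg.2 h'.le) h.le le_rfl h'
  have := inf_add_eq_zero h.nonneg (sub_nonneg.2 h'.le) (sub_nonneg.2 h.le) h1 h
  rwa [sub_add_sub_cancel] at this

theorem IsComponent.add {r q p : X} (h : IsComponent q p) (h' : IsComponent r (p - q)) :
    IsComponent (q + r) p := by
  have hle : 0 ≤ p - (q + r) := by rw [← sub_sub]; exact sub_nonneg.2 h'.le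
  have h1 : (p - (q + r)) ⊓ q = 0 := by
    rw [inf_comm]
    exact inf_eq_zero_of_le h.nonneg hle le_rfl
      (sub_le_sub_left (le_add_of_nonneg_right h'.nonneg) p) h
  have h2 : (p - (q + r)) ⊓ r = 0 := by rw [inf_comm, ← sub_sub]; exact h'
  rw [IsComponent, inf_comm]
  exact inf_add_eq_zero hle h.nonneg h'.nonneg h1 h2

theorem isClosed_isComponent (p : X) : IsClosed {q : X | IsComponent q p} :=
  isClosed_eq (by fun_prop) continuous_const

/-- `q = lim (n • w ⊓ p)` is the projection of `p` onto the band generated by `w`. -/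
theorem MonotoneCauchy.exists_component_generated [CompleteSpace X] (hX : MonotoneCauchy X)
    {p w : X} (hw : 0 ≤ w) (hwp : w ≤ p) :
    ∃ q, IsComponent q p ∧ w ≤ q ∧ ∀ v, 0 ≤ v → v ⊓ w = 0 → v ⊓ q = 0 := by
  have hp : 0 ≤ p := hw.trans hwp
  have hmono : Monotone fun n : ℕ => n • w ⊓ p := fun m n hmn =>
    inf_le_inf (nsmul_le_nsmul_left hw hmn) le_rfl
  obtain ⟨q, hq⟩ := cauchySeq_tendsto_of_complete (hX _ p hmono fun n => inf_le_right)
  have hle : ∀ n : ℕ, n • w ⊓ p ≤ q := hmono.ge_of_tendsto hq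
  have hwq : w ≤ q := by simpa [inf_eq_left.2 hwp] using hle 1
  have hqp : q ≤ p := le_of_tendsto' hq fun n => inf_le_right
  refine ⟨q, le_antisymm ?_ (le_inf (hw.trans hwq) (sub_nonneg.2 hqp)), hwq, fun v hv hvw => ?_⟩
  -- With `qₙ = n • w ⊓ p`, one has `qₙ + qₙ ⊓ (p - qₙ) = (qₙ + qₙ) ⊓ p ≤ (n + n) • w ⊓ p ≤ q`; pass
  -- to the limit.
  · have h1 : Tendsto (fun n : ℕ => n • w ⊓ p + (n • w ⊓ p) ⊓ (p - n • w ⊓ p)) atTop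
        (𝓝 (q + q ⊓ (p - q))) := hq.add (hq.inf_nhds (tendsto_const_nhds.sub hq))
    have h2 : q + q ⊓ (p - q) ≤ q := by
      refine le_of_tendsto' h1 fun n => ?_
      rw [add_inf, add_sub_cancel]
      refine le_trans (inf_le_inf ?_ le_rfl) (hle (n + n))
      rw [add_nsmul]
      exact add_le_add inf_le_left inf_le_left
    simpa using h2
  · have h1 : Tendsto (fun n : ℕ => v ⊓ (n • w ⊓ p)) atTop (𝓝 (v ⊓ q)) :=
      tendsto_const_nhds.inf_nhds hq
    refine tendsto_nhds_unique h1 (tendsto_const_nhds.congr fun n => ?_)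
    exact (inf_eq_zero_of_le hv (le_inf (nsmul_nonneg hw n) hp) le_rfl inf_le_left
      (nsmul_inf_eq_zero hv hw hvw n)).symm

theorem exists_not_smul_of_not_atom {p : X} (hp : 0 ≤ p) (hne : p ≠ 0) (hat : ¬ IsLatticeAtom p) :
    ∃ y, 0 ≤ y ∧ y ≤ p ∧ ∀ c : ℝ, y ≠ c • p := by
  obtain ⟨x, ⟨c, hc⟩, hx⟩ : ∃ x ∈ principalIdeal p, ∀ c : ℝ, x ≠ c • p := by
    by_contra! h
    refine hat ⟨hp, hne, Set.Subset.antisymm h ?_⟩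
    rintro _ ⟨c, rfl⟩
    exact ⟨|c|, abs_smul_le c p⟩
  rw [abs_of_nonneg hp] at hc
  obtain ⟨y, hy, hyx, hyc⟩ : ∃ y, 0 ≤ y ∧ y ≤ |x| ∧ ∀ c : ℝ, y ≠ c • p := by
    by_contra! h
    obtain ⟨s, hs⟩ := h x⁺ (posPart_nonneg x) (sup_le (le_abs_self x) (abs_nonneg x))
    obtain ⟨t, ht⟩ := h x⁻ (negPart_nonneg x) (sup_le (neg_le_abs x) (abs_nonneg x))
    exact hx (s - t) (by rw [sub_smul, ← hs, ← ht, posPart_sub_negPart])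
  -- The constant `c` carries no sign, so `max c 1` serves as the positive scaling factor.
  have hm : 0 < max c 1 := by positivity
  refine ⟨(max c 1)⁻¹ • y, smul_nonneg (by positivity) hy, ?_, fun d hd => ?_⟩
  · rw [inv_smul_le_iff_of_pos hm]
    exact (hyx.trans hc).trans (smul_le_smul_of_nonneg_right (le_max_left _ _) hp)
  · refine hyc (max c 1 * d) ?_
    rw [mul_smul, ← hd, smul_inv_smul₀ hm.ne']

/-- Subtracting from `y` its largest multiple of `p` leaves `z ≠ 0` with no positive multiple of `p`
below it. For small `s > 0` also `z ≰ s • p`, so `z - s • p` has both signs. -/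
theorem exists_signed_of_not_atom {p : X} (hp : 0 ≤ p) (hne : p ≠ 0) (hat : ¬ IsLatticeAtom p) :
    ∃ v : X, v⁺ ≠ 0 ∧ v⁻ ≠ 0 ∧ v⁺ ≤ p ∧ v⁻ ≤ p := by
  obtain ⟨y, hy, hyp, hyc⟩ := exists_not_smul_of_not_atom hp hne hat
  set S : Set ℝ := {t | t • p ≤ y} with hS
  have hcl : IsClosed S := isClosed_le (by fun_prop) continuous_const
  have h0 : (0 : ℝ) ∈ S := by simpa [hS] using hy
  have hbdd : BddAbove S := by
    refine ⟨1, fun t ht => ?_⟩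
    by_contra! h
    have h1 : (t - 1) • p ≤ 0 := by
      rw [sub_smul, one_smul]
      exact sub_nonpos.2 (le_trans ht hyp)
    exact hne (le_antisymm (by simpa using (le_inv_smul_iff_of_pos (sub_pos.2 h)).2 h1) hp)
  have hmem : sSup S ∈ S := hcl.csSup_mem ⟨0, h0⟩ hbdd
  set z := y - sSup S • p with hz
  have hz0 : 0 ≤ z := sub_nonneg.2 hmem
  have hzne : z ≠ 0 := fun h => hyc _ (sub_eq_zero.1 h)
  have hzp : z ≤ p := (sub_le_self _ (smul_nonneg (le_csSup hbdd h0) hp)).trans hyp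
  have hns : ∀ s : ℝ, 0 < s → ¬ s • p ≤ z := fun s hs h => by
    have : s + sSup S ∈ S := by
      change (s + sSup S) • p ≤ y
      rw [add_smul]
      exact le_sub_iff_add_le.1 h
    linarith [le_csSup hbdd this]
  obtain ⟨n, hn⟩ : ∃ n : ℕ, ¬ z ≤ (1 / ((n : ℝ) + 1)) • p := by
    by_contra! h
    refine hzne (le_antisymm ?_ hz0)
    have := (tendsto_one_div_add_atTop_nhds_zero_nat (𝕜 := ℝ)).smul_const p
    rw [zero_smul] at this
    exact ge_of_tendsto' this h
  have hs : (0 : ℝ) < 1 / ((n : ℝ) + 1) := by positivity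
  have hs1 : 1 / ((n : ℝ) + 1) ≤ 1 := by
    rw [div_le_one (by positivity)]
    linarith [n.cast_nonneg (α := ℝ)]
  have hsp := smul_nonneg hs.le hp
  refine ⟨z - (1 / ((n : ℝ) + 1)) • p, fun h => hn ?_, fun h => hns _ hs ?_, ?_, ?_⟩
  · exact sub_nonpos.1 (posPart_eq_zero.1 h)
  · exact sub_nonneg.1 (negPart_eq_zero.1 h)
  · exact sup_le ((sub_le_self _ hsp).trans hzp) hp
  · refine sup_le ?_ hp
    rw [neg_sub]
    refine (sub_le_self _ hz0).trans ?_
    simpa using smul_le_smul_of_nonneg_right hs1 hp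

/-- The component generated by `v⁺` contains `v⁺` and is disjoint from `v⁻`, so it is neither `0`
nor `p`. -/
theorem MonotoneCauchy.exists_component_ne [CompleteSpace X] (hX : MonotoneCauchy X) {p : X}
    (hp : 0 ≤ p) (hne : p ≠ 0) (hat : ¬ IsLatticeAtom p) :
    ∃ q, IsComponent q p ∧ q ≠ 0 ∧ p - q ≠ 0 := by
  obtain ⟨v, hv, hv', hvp, hvp'⟩ := exists_signed_of_not_atom hp hne hat
  obtain ⟨q, hq, hwq, hd⟩ := hX.exists_component_generated (posPart_nonneg v) hvp
  refine ⟨q, hq, ?_, fun h => ?_⟩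
  · rintro rfl
    exact hv (le_antisymm hwq (posPart_nonneg v))
  · have := hd v⁻ (negPart_nonneg v) (by rw [inf_comm]; exact posPart_inf_negPart_eq_zero v)
    rw [← sub_eq_zero.1 h, inf_eq_left.2 hvp'] at this
    exact hv' this

/-- Split repeatedly, keeping the part with the smaller value of `f`. -/
theorem MonotoneCauchy.exists_component_lt [CompleteSpace X] (hX : MonotoneCauchy X)
    (f : StrongDual ℝ X) {e : X} (he : ∀ a ≤ e, ¬ IsLatticeAtom a) {p : X} (hp : 0 ≤ p)
    (hpe : p ≤ e) (hne : p ≠ 0) {η : ℝ} (hη : 0 < η) :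
    ∃ q, IsComponent q p ∧ q ≠ 0 ∧ f q < η := by
  have key : ∀ n : ℕ, ∃ q, IsComponent q p ∧ q ≠ 0 ∧ f q ≤ f p * (1 / 2) ^ n := fun n => by
    induction n with
    | zero => exact ⟨p, by simpa [IsComponent] using hp, hne, by simp⟩
    | succ n ih =>
      obtain ⟨q, hq, hq0, hqf⟩ := ih
      obtain ⟨r, hr, hr0, hr0'⟩ := hX.exists_component_ne hq.nonneg hq0 (he q (hq.le.trans hpe))
      have hadd : f (q - r) = f q - f r := map_sub f q r
      rw [pow_succ]
      rcases le_total (f r) (f q / 2) with h | h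
      · exact ⟨r, hr.trans hq, hr0, by linarith⟩
      · exact ⟨q - r, hr.compl.trans hq, hr0', by linarith⟩
  have hlim : Tendsto (fun n : ℕ => f p * (1 / 2 : ℝ) ^ n) atTop (𝓝 0) := by
    simpa using (tendsto_pow_atTop_nhds_zero_of_lt_one (r := (1 / 2 : ℝ)) (by norm_num)
      (by norm_num)).const_mul (f p)
  obtain ⟨n, hn⟩ := (hlim.eventually (gt_mem_nhds hη)).exists
  obtain ⟨q, hq, hq0, hqf⟩ := key n
  exact ⟨q, hq, hq0, hqf.trans_lt hn⟩

/-- By Zorn there is a maximal component of mass at most `f p / 2`. If its mass were smaller, a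
component of the rest with small enough mass could be added. -/
theorem MonotoneCauchy.exists_half [CompleteSpace X] (hX : MonotoneCauchy X)
    {f : StrongDual ℝ X} {e : X} (hf : StrictlyPositiveOn f e)
    (he : ∀ a ≤ e, ¬ IsLatticeAtom a) {p : X} (hp : 0 ≤ p) (hpe : p ≤ e) :
    ∃ q, IsComponent q p ∧ f q = f p / 2 := by
  have hfp := hf.nonneg p hp
  set S : Set X := {q | IsComponent q p ∧ f q ≤ f p / 2} with hS
  have hSc : IsClosed S := (isClosed_isComponent p).inter
    (isClosed_le f.continuous continuous_const)
  have h0 : (0 : X) ∈ S := ⟨by simpa [IsComponent] using hp, by rw [map_zero]; linarith⟩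
  obtain ⟨m, -, hm⟩ := zorn_le_nonempty₀ S (fun c hcS hc y hy => by
    obtain ⟨x, hx, hx'⟩ := hX.exists_isLUB ⟨y, hy⟩ hc.directedOn
      (fun z hz => (hcS hz).1.le : p ∈ upperBounds c)
    exact ⟨x, closure_minimal hcS hSc hx, fun z hz => hx'.1 hz⟩) 0 h0
  refine ⟨m, hm.prop.1, le_antisymm hm.prop.2 ?_⟩
  by_contra! hlt
  have hne : p - m ≠ 0 := fun h => by
    rw [sub_eq_zero.1 h] at hlt hfp
    linarith
  obtain ⟨q, hq, hq0, hqf⟩ := hX.exists_component_lt f he (sub_nonneg.2 hm.prop.1.le)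
    ((sub_le_self _ hm.prop.1.nonneg).trans hpe) hne (sub_pos.2 hlt)
  have hmem : m + q ∈ S := ⟨hm.prop.1.add hq, by rw [map_add]; linarith⟩
  have hle := hm.le_of_ge hmem (le_add_of_nonneg_right hq.nonneg)
  exact hq0 (le_antisymm (by simpa using hle) hq.nonneg)

end Components

/-! ### Scalar Rademacher sums -/

theorem sum_range_two_pow_succ {M : Type*} [AddCommMonoid M] (g : ℕ → M) (n : ℕ) :
    ∑ k ∈ Finset.range (2 ^ (n + 1)), g k =
      ∑ k ∈ Finset.range (2 ^ n), (g (2 * k) + g (2 * k + 1)) := by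
  have key : ∀ m : ℕ, ∑ k ∈ Finset.range (2 * m), g k =
      ∑ k ∈ Finset.range m, (g (2 * k) + g (2 * k + 1)) := fun m => by
    induction m with
    | zero => simp
    | succ m ih =>
      rw [Finset.sum_range_succ, ← ih, Nat.mul_succ, Finset.sum_range_succ,
        Finset.sum_range_succ, add_assoc]
  rw [pow_succ', key]

/-- The coefficients of `∑ m < n, a m * r m` on dyadic intervals of length `2⁻ⁿ`, where `r m` is
the `m`-th Rademacher function. -/
def dyadicCoeff (a : ℕ → ℝ) : ℕ → ℕ → ℝ
  | 0, _ => 0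
  | n + 1, k => dyadicCoeff a n (k / 2) + if k % 2 = 0 then a n else -a n

theorem dyadicCoeff_even (a : ℕ → ℝ) (n k : ℕ) :
    dyadicCoeff a (n + 1) (2 * k) = dyadicCoeff a n k + a n := by
  simp [dyadicCoeff]

theorem dyadicCoeff_odd (a : ℕ → ℝ) (n k : ℕ) :
    dyadicCoeff a (n + 1) (2 * k + 1) = dyadicCoeff a n k - a n := by
  have h1 : (2 * k + 1) / 2 = k := by omega
  have h2 : (2 * k + 1) % 2 = 1 := by omega
  simp [dyadicCoeff, h1, h2, sub_eq_add_neg]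

/-- Orthogonality of the Rademacher functions: the cross terms in `(c + a)² + (c - a)²` cancel. -/
theorem sum_dyadicCoeff_sq (a : ℕ → ℝ) (n : ℕ) :
    ∑ k ∈ Finset.range (2 ^ n), dyadicCoeff a n k ^ 2 =
      2 ^ n * ∑ m ∈ Finset.range n, a m ^ 2 := by
  induction n with
  | zero => simp [dyadicCoeff]
  | succ n ih =>
    rw [sum_range_two_pow_succ, Finset.sum_range_succ]
    simp_rw [dyadicCoeff_even, dyadicCoeff_odd]
    have : ∀ k, (dyadicCoeff a n k + a n) ^ 2 + (dyadicCoeff a n k - a n) ^ 2 =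
        2 * dyadicCoeff a n k ^ 2 + 2 * a n ^ 2 := fun k => by ring
    simp_rw [this]
    rw [Finset.sum_add_distrib, ← Finset.mul_sum, ih]
    simp
    ring

theorem sum_abs_dyadicCoeff_sq_le (a : ℕ → ℝ) (n : ℕ) :
    (∑ k ∈ Finset.range (2 ^ n), |dyadicCoeff a n k|) ^ 2 ≤
      (2 ^ n) ^ 2 * ∑ m ∈ Finset.range n, a m ^ 2 := by
  have h := sq_sum_le_card_mul_sum_sq (s := Finset.range (2 ^ n))
    (f := fun k => |dyadicCoeff a n k|)
  simp only [sq_abs, sum_dyadicCoeff_sq, Finset.card_range] at h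
  push_cast at h
  linarith

/-! ### Rademacher sequences in an atomless interval -/

section Rademacher

/-- The dyadic tree that a halving map `h` grows from `e`; level `n` is indexed by `k < 2 ^ n`. -/
def dyadicPart (h : X → X) (e : X) : ℕ → ℕ → X
  | 0, _ => e
  | n + 1, k => if k % 2 = 0 then h (dyadicPart h e n (k / 2)) else
      dyadicPart h e n (k / 2) - h (dyadicPart h e n (k / 2))

/-- The Rademacher sequence of the dyadic tree. -/
def rademacher (h : X → X) (e : X) (n : ℕ) : X :=
  ∑ k ∈ Finset.range (2 ^ n), (dyadicPart h e (n + 1) (2 * k) - dyadicPart h e (n + 1) (2 * k + 1))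

variable {h : X → X} {e : X} {f : StrongDual ℝ X}

theorem dyadicPart_even (n k : ℕ) :
    dyadicPart h e (n + 1) (2 * k) = h (dyadicPart h e n k) := by
  simp [dyadicPart]

theorem dyadicPart_odd (n k : ℕ) :
    dyadicPart h e (n + 1) (2 * k + 1) = dyadicPart h e n k - h (dyadicPart h e n k) := by
  have h1 : (2 * k + 1) / 2 = k := by omega
  have h2 : (2 * k + 1) % 2 = 1 := by omega
  simp [dyadicPart, h1, h2]

theorem dyadicPart_even_add_odd (n k : ℕ) :
    dyadicPart h e (n + 1) (2 * k) + dyadicPart h e (n + 1) (2 * k + 1) = dyadicPart h e n k := by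
  rw [dyadicPart_even, dyadicPart_odd, add_sub_cancel]

theorem sum_dyadicPart (n : ℕ) : ∑ k ∈ Finset.range (2 ^ n), dyadicPart h e n k = e := by
  induction n with
  | zero => simp [dyadicPart]
  | succ n ih =>
    rw [sum_range_two_pow_succ]
    simpa only [dyadicPart_even_add_odd] using ih

theorem sum_smul_rademacher (a : ℕ → ℝ) (n : ℕ) :
    ∑ m ∈ Finset.range n, a m • rademacher h e m =
      ∑ k ∈ Finset.range (2 ^ n), dyadicCoeff a n k • dyadicPart h e n k := by
  induction n with
  | zero => simp [dyadicCoeff]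
  | succ n ih =>
    rw [Finset.sum_range_succ, ih, sum_range_two_pow_succ, rademacher, Finset.smul_sum,
      ← Finset.sum_add_distrib]
    refine Finset.sum_congr rfl fun k _ => ?_
    rw [dyadicCoeff_even, dyadicCoeff_odd, ← dyadicPart_even_add_odd n k]
    module

theorem dyadicPart_mem (hh : ∀ p, 0 ≤ p → p ≤ e → IsComponent (h p) p) (he : 0 ≤ e) (n k : ℕ) :
    0 ≤ dyadicPart h e n k ∧ dyadicPart h e n k ≤ e := by
  induction n generalizing k with
  | zero => exact ⟨he, le_rfl⟩
  | succ n ih =>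
    obtain ⟨h0, h1⟩ := ih (k / 2)
    have hc := hh _ h0 h1
    rw [dyadicPart]
    split_ifs
    · exact ⟨hc.nonneg, hc.le.trans h1⟩
    · exact ⟨sub_nonneg.2 hc.le, (sub_le_self _ hc.nonneg).trans h1⟩

theorem dyadicPart_le (hh : ∀ p, 0 ≤ p → p ≤ e → IsComponent (h p) p) (he : 0 ≤ e) (n k : ℕ) :
    dyadicPart h e (n + 1) k ≤ dyadicPart h e n (k / 2) := by
  obtain ⟨h0, h1⟩ := dyadicPart_mem hh he n (k / 2)
  have hc := hh _ h0 h1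
  rw [dyadicPart]
  split_ifs
  · exact hc.le
  · exact sub_le_self _ hc.nonneg

theorem dyadicPart_inf (hh : ∀ p, 0 ≤ p → p ≤ e → IsComponent (h p) p) (he : 0 ≤ e) (n k l : ℕ)
    (hk : k < 2 ^ n) (hl : l < 2 ^ n) (hkl : k ≠ l) :
    dyadicPart h e n k ⊓ dyadicPart h e n l = 0 := by
  induction n generalizing k l with
  | zero => simp at hk hl; omega
  | succ n ih =>
    by_cases hd : k / 2 = l / 2
    · obtain ⟨h0, h1⟩ := dyadicPart_mem hh he n (k / 2)
      have hc := hh _ h0 h1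
      rw [dyadicPart, dyadicPart, ← hd]
      split_ifs
      · omega
      · exact hc
      · rw [inf_comm]; exact hc
      · omega
    · exact inf_eq_zero_of_le (dyadicPart_mem hh he _ _).1 (dyadicPart_mem hh he _ _).1
        (dyadicPart_le hh he n k) (dyadicPart_le hh he n l)
        (ih (k / 2) (l / 2) (by omega) (by omega) hd)

/-- The even and odd parts are disjoint with sum `e`, and `|u - v| = u + v` for disjoint positive
`u`, `v`. -/
theorem abs_rademacher (hh : ∀ p, 0 ≤ p → p ≤ e → IsComponent (h p) p) (he : 0 ≤ e) (n : ℕ) :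
    |rademacher h e n| = e := by
  have h0 : ∀ n k, 0 ≤ dyadicPart h e n k := fun n k => (dyadicPart_mem hh he n k).1
  set u := ∑ k ∈ Finset.range (2 ^ n), dyadicPart h e (n + 1) (2 * k) with hu
  set v := ∑ k ∈ Finset.range (2 ^ n), dyadicPart h e (n + 1) (2 * k + 1) with hv
  have hu0 : 0 ≤ u := Finset.sum_nonneg fun k _ => h0 _ _
  have huv : u ⊓ v = 0 := by
    refine inf_sum_eq_zero hu0 (fun k _ => h0 _ _) fun k hk => ?_
    rw [inf_comm]
    refine inf_sum_eq_zero (h0 _ _) (fun l _ => h0 _ _) fun l hl => ?_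
    rw [Finset.mem_range] at hk hl
    exact dyadicPart_inf hh he _ _ _ (by omega) (by omega) (by omega)
  have hadd : u + v = e := by
    rw [← Finset.sum_add_distrib, ← sum_range_two_pow_succ, sum_dyadicPart]
  rw [rademacher, Finset.sum_sub_distrib, ← sup_sub_inf_eq_abs_sub, inf_comm, sup_comm, huv,
    sub_zero]
  have := inf_add_sup u v
  rwa [huv, zero_add, hadd] at this

theorem apply_dyadicPart (hh : ∀ p, 0 ≤ p → p ≤ e → IsComponent (h p) p) (he : 0 ≤ e)
    (hf : ∀ p, 0 ≤ p → p ≤ e → f (h p) = f p / 2) (n k : ℕ) :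
    f (dyadicPart h e n k) = f e / 2 ^ n := by
  induction n generalizing k with
  | zero => simp [dyadicPart]
  | succ n ih =>
    obtain ⟨h0, h1⟩ := dyadicPart_mem hh he n (k / 2)
    rw [dyadicPart]
    split_ifs
    · rw [hf _ h0 h1, ih, pow_succ]; field_simp
    · rw [map_sub, hf _ h0 h1, ih, pow_succ]; field_simp; ring

/-- `f` acts as an integral giving each piece of level `n` the mass `f e / 2 ^ n`; this is the bound
of the L¹ norm by the L² norm. -/
theorem apply_abs_sum_rademacher_sq_le (hh : ∀ p, 0 ≤ p → p ≤ e → IsComponent (h p) p)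
    (he : 0 ≤ e) (hf : ∀ p, 0 ≤ p → p ≤ e → f (h p) = f p / 2) (hpos : StrictlyPositiveOn f e)
    (a : ℕ → ℝ) (n : ℕ) :
    f |∑ m ∈ Finset.range n, a m • rademacher h e m| ^ 2 ≤
      f e ^ 2 * ∑ m ∈ Finset.range n, a m ^ 2 := by
  have h1 : |∑ m ∈ Finset.range n, a m • rademacher h e m| ≤
      ∑ k ∈ Finset.range (2 ^ n), |dyadicCoeff a n k| • dyadicPart h e n k := by
    rw [sum_smul_rademacher]
    refine abs_sum_le_sum fun k _ => (abs_smul_le _ _).trans_eq ?_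
    rw [abs_of_nonneg (dyadicPart_mem hh he n k).1]
  have h2 := hpos.mono h1
  simp_rw [map_sum, map_smul, smul_eq_mul, apply_dyadicPart hh he hf] at h2
  rw [← Finset.sum_mul] at h2
  calc _ ≤ ((∑ k ∈ Finset.range (2 ^ n), |dyadicCoeff a n k|) * (f e / 2 ^ n)) ^ 2 :=
        pow_le_pow_left₀ (hpos.nonneg _ (abs_nonneg _)) h2 2
    _ = (∑ k ∈ Finset.range (2 ^ n), |dyadicCoeff a n k|) ^ 2 * (f e / 2 ^ n) ^ 2 := mul_pow _ _ _
    _ ≤ ((2 ^ n) ^ 2 * ∑ m ∈ Finset.range n, a m ^ 2) * (f e / 2 ^ n) ^ 2 := by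
        gcongr
        exact sum_abs_dyadicCoeff_sq_le a n
    _ = _ := by field_simp

/-- If `|g (r m)| ≥ δ` for infinitely many `m`, average `N` of these `r m` with the signs of `g (r
m)`. The average `T` has `|T| ≤ e` and `g T ≥ δ`, but `f |T| ^ 2 ≤ f e ^ 2 / N`, so its norm is
small for large `N`. -/
theorem weakTendsto_rademacher [CompleteSpace X] (hX : MonotoneCauchy X)
    (hh : ∀ p, 0 ≤ p → p ≤ e → IsComponent (h p) p) (he : 0 ≤ e)
    (hf : ∀ p, 0 ≤ p → p ≤ e → f (h p) = f p / 2) (hpos : StrictlyPositiveOn f e) :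
    WeakTendsto (rademacher h e) atTop 0 := by
  refine weakTendsto_zero_iff.2 fun g => ?_
  rw [Metric.tendsto_nhds]
  intro δ hδ
  by_contra hcon
  have hinf : {n | δ ≤ |g (rademacher h e n)|}.Infinite := by
    rw [← Nat.frequently_atTop_iff_infinite]
    refine (not_eventually.1 hcon).mono fun n hn => ?_
    simpa using hn
  obtain ⟨η, hη, hsmall⟩ := hpos.exists_norm_lt hX
    -- The `+ 1` covers `g = 0`; a norm below this bound gives `g T < δ`.
    (show 0 < δ / (‖g‖ + 1) by positivity)
  obtain ⟨N, hN⟩ := exists_nat_gt (f e ^ 2 / η ^ 2)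
  have hN0 : (0 : ℝ) < N := lt_of_le_of_lt (by positivity) hN
  obtain ⟨A, hA, hAN⟩ := hinf.exists_subset_card_eq N
  obtain ⟨M, hM⟩ := A.exists_nat_subset_range
  set a : ℕ → ℝ := fun m =>
    if m ∈ A then (SignType.sign (g (rademacher h e m)) : ℝ) / N else 0 with ha
  have hsum : ∀ {E : Type _} [AddCommGroup E] (F : ℕ → E), (∀ m ∉ A, F m = 0) →
      ∑ m ∈ Finset.range M, F m = ∑ m ∈ A, F m := fun F hF =>
    (Finset.sum_subset hM fun m _ hm => hF m hm).symm
  have habs : ∀ m, |a m| ≤ if m ∈ A then 1 / (N : ℝ) else 0 := fun m => by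
    by_cases hm : m ∈ A
    · simp only [ha, hm, if_true, abs_div, Nat.abs_cast]
      gcongr
      rcases lt_trichotomy (g (rademacher h e m)) 0 with h | h | h <;> simp [h]
    · simp [ha, hm]
  set T := ∑ m ∈ Finset.range M, a m • rademacher h e m with hT
  have hTe : |T| ≤ e := by
    have h1 : |T| ≤ ∑ m ∈ Finset.range M, (if m ∈ A then 1 / (N : ℝ) else 0) • e :=
      abs_sum_le_sum fun m _ => (abs_smul_le _ _).trans (by
        rw [abs_rademacher hh he]
        exact smul_le_smul_of_nonneg_right (habs m) he)
    refine h1.trans_eq ?_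
    rw [← Finset.sum_smul, hsum _ (fun m hm => by simp [hm]), Finset.sum_ite_mem, Finset.inter_self,
      Finset.sum_const, hAN, nsmul_eq_mul, mul_one_div_cancel hN0.ne', one_smul]
  have hsq : ∑ m ∈ Finset.range M, a m ^ 2 ≤ 1 / N := by
    have h1 : ∀ m, a m ^ 2 ≤ if m ∈ A then (1 / (N : ℝ)) ^ 2 else 0 := fun m => by
      have := pow_le_pow_left₀ (abs_nonneg _) (habs m) 2
      rw [sq_abs] at this
      refine this.trans_eq ?_
      split_ifs <;> simp
    refine (Finset.sum_le_sum fun m _ => h1 m).trans_eq ?_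
    rw [hsum _ (fun m hm => by simp [hm]), Finset.sum_ite_mem, Finset.inter_self,
      Finset.sum_const, hAN, nsmul_eq_mul]
    field_simp
  have hfT : f |T| < η := by
    refine lt_of_pow_lt_pow_left₀ 2 hη.le ?_
    refine (apply_abs_sum_rademacher_sq_le hh he hf hpos a M).trans_lt ?_
    refine (mul_le_mul_of_nonneg_left hsq (sq_nonneg _)).trans_lt ?_
    rw [mul_one_div, div_lt_iff₀ hN0]
    rwa [div_lt_iff₀ (by positivity), mul_comm] at hN
  have hTn := hsmall |T| (abs_nonneg T) hTe hfT
  rw [norm_abs_eq_norm, lt_div_iff₀ (by positivity)] at hTn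
  have hgT : δ ≤ g T := by
    rw [hT, map_sum, hsum _ (fun m hm => by simp [ha, hm])]
    have h1 : ∀ m ∈ A, δ / N ≤ g (a m • rademacher h e m) := fun m hm => by
      have h2 : g (a m • rademacher h e m) = |g (rademacher h e m)| / N := by
        simp only [ha, hm, if_true, map_smul, smul_eq_mul]
        rw [div_mul_eq_mul_div, sign_mul_self]
      rw [h2]
      gcongr
      exact hA hm
    have h3 := Finset.card_nsmul_le_sum A _ _ h1
    rwa [hAN, nsmul_eq_mul, mul_div_cancel₀ _ hN0.ne'] at h3
  have h4 := (le_abs_self _).trans (g.le_opNorm T)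
  nlinarith [norm_nonneg T]

end Rademacher

theorem isAtomicLattice_of_weak_imp_un [CompleteSpace X]
    (hW : ∀ x : ℕ → X, WeakTendsto x atTop 0 → UnTendsto x atTop 0) : IsAtomicLattice X := by
  have hX : MonotoneCauchy X := (disjointNull_of_weak_imp_un hW).monotoneCauchy
  by_contra hA
  obtain ⟨e₀, he₀, hne₀, hat₀⟩ := hX.exists_no_atoms_below hA
  obtain ⟨f, e, he, hee, hne, hpos⟩ := hX.exists_strictlyPositiveOn he₀ hne₀
  -- The halving map is total, with arbitrary values outside `[0, e]`; the dyadic tree never leaves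
  -- this interval.
  choose! h hh hf using fun (p : X) (hp : 0 ≤ p) (hpe : p ≤ e) =>
    hX.exists_half hpos (fun a ha => hat₀ a (ha.trans hee)) hp hpe
  have hlim := norm_tendsto_of_unTendsto (fun n => (abs_rademacher hh he n).le)
    (hW _ (weakTendsto_rademacher hX hh he hf hpos))
  have hconst : ∀ n, ‖rademacher h e n‖ = ‖e‖ := fun n => by
    rw [← norm_abs_eq_norm, abs_rademacher hh he]
  simp_rw [hconst] at hlim
  exact hne (norm_eq_zero.1 (tendsto_nhds_unique tendsto_const_nhds hlim))

end BanachLattice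

theorem mainTheorem5 {X : Type*} [NormedAddCommGroup X] [NormedSpace ℝ X] [CompleteSpace X]
    [Lattice X] [IsOrderedAddMonoid X] [IsOrderedModule ℝ X] [HasSolidNorm X] :
    (∀ x : ℕ → X, BanachLattice.WeakTendsto x atTop 0 → BanachLattice.UnTendsto x atTop 0) ↔
      (BanachLattice.IsOrderContinuous X ∧ BanachLattice.IsAtomicLattice X) :=
  ⟨fun h => ⟨(BanachLattice.disjointNull_of_weak_imp_un h).monotoneCauchy.isOrderContinuous,
    BanachLattice.isAtomicLattice_of_weak_imp_un h⟩,
    fun h _ hx => BanachLattice.unTendsto_of_weakTendsto h.1 h.2 hx⟩
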